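/- Let $K$ be a field, let $f\in K[x]$ be nonzero of degree $n$, let $a\in K[x]$, and let $m\ge 1$. Let $\mathcal R_m=\mathcal R_m^{(a,f)}$ be the $K[y]$-module of polynomials $r(x,y)=r_0(y)+\cdots+r_{m-1}(y)x^{m-1}\in K[x,y]$ such that $r(x,a(x))\equiv 0 \bmod f$, identified with the submodule of $K[y]^m$ formed by the coefficient vectors $(r_0,\dots,r_{m-1})^{T}$. A matrix of relations of $\mathcal R_m$ is a nonsingular matrix in $K[y]^{m\times m}$ whose columns lie in $\mathcal R_m$; it is a basis of relations if its columns generate $\mathcal R_m$. The determinantal degree $\nu_m$ of $\mathcal R_m$ is the minimal degree of the determinant of a matrix of relations of $\mathcal R_m$. Let $M_a\in K^{n\times n}$ be the matrix of multiplication by $a$ in $K[x]/(f)$ in the basis $(1,x,\dots,x^{n-1})$. The invariant factors of $\mathcal R_m$ are the monic polynomials $d_1,\dots,d_m$ with $d_{i+1}\mid d_i$ such that, for some basis $(b_1,\dots,b_m)$ of $K[y]^m$, the vectors $d_1b_1,\dots,d_mb_m$ generate $\mathcal R_m$. The invariant factors $\sigma_1,\dots,\sigma_n$ of $yI_n-M_a$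 are the monic diagonal entries of its Smith normal form, ordered so that $\sigma_{i+1}\mid\sigma_i$. Both lists exist and are unique, and the following hold. 1. If $B$ is an upper triangular basis of relations of $\mathcal R_m$, then for every $i$ its $i$-th diagonal entry equals $d_i$ up to multiplication by a nonzero element of $K$. 2. There is $k\le\min(m,n)$ such that $d_1,\dots,d_k$ are exactly the nontrivial (that is, nonconstant) ones among the invariant factors of $\mathcal R_m$, and $d_i=\sigma_i$ for $1\le i\le k$; that is, they are the $k$ invariant factors of highest degree of $yI_n-M_a$. 3. The matrix $yI_n-M_a$ is a basis of relations of $\mathcal R_n$. 4. $\nu_m=\sum_{i=1}^m\deg d_i=\sum_{i=1}^{\min(m,n)}\deg\sigma_i$, and $\min(m,n)\le\nu_m\le n$. -/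

import Mathlib

open Polynomial

section Relations

variable {K : Type*} [Field K]

/-- The module of relations of `x`-degree less than `m`. A bivariate polynomial
`r = r_0(y) + ⋯ + r_{m-1}(y) x^{m-1}` is identified with the vector `(r_0, …, r_{m-1})` of its
coefficients in `K[y]`; it is a relation when `r(x, a(x))` vanishes modulo `f`. -/
def relationModule (a f : K[X]) (m : ℕ) : Submodule K[X] (Fin m → K[X]) where
  carrier := {r | f ∣ ∑ i : Fin m, (r i).comp a * X ^ (i : ℕ)}
  zero_mem' := by simp
  add_mem' := by
    intro r s hr hs
    have h := dvd_add hr hs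
    rw [← Finset.sum_add_distrib] at h
    simpa [add_mul] using h
  smul_mem' := by
    intro p r hr
    have h := Dvd.dvd.mul_left hr (p.comp a)
    rw [Finset.mul_sum] at h
    simpa [mul_assoc] using h

/-- A nonsingular square matrix whose columns belong to the module `N`. -/
def IsMatrixOfRelations {m : ℕ} (N : Submodule K[X] (Fin m → K[X]))
    (B : Matrix (Fin m) (Fin m) K[X]) : Prop :=
  B.det ≠ 0 ∧ ∀ j, (fun i => B i j) ∈ N

/-- A matrix of relations whose columns generate the module `N`. -/
def IsBasisOfRelations {m : ℕ} (N : Submodule K[X] (Fin m → K[X]))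
    (B : Matrix (Fin m) (Fin m) K[X]) : Prop :=
  IsMatrixOfRelations N B ∧ Submodule.span K[X] (Set.range fun j i => B i j) = N

/-- The determinantal degree: the least degree of the determinant of a matrix of relations. -/
noncomputable def determinantalDegree {m : ℕ} (N : Submodule K[X] (Fin m → K[X])) : ℕ :=
  sInf {e | ∃ B : Matrix (Fin m) (Fin m) K[X], IsMatrixOfRelations N B ∧ B.det.natDegree = e}

/-- Normalization of a family of invariant factors: each one is monic (or zero), and they are
listed from the largest to the smallest for divisibility. -/
def IsNormalizedChain {m : ℕ} (d : Fin m → K[X]) : Prop :=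
  (∀ i, d i = 0 ∨ (d i).Monic) ∧ ∀ i j, i ≤ j → d j ∣ d i

/-- `d` lists the invariant factors of the submodule `N` of `K[y]^m`: for some basis `b` of
`K[y]^m`, the module `N` is generated by the multiples `d i • b i`. -/
def IsInvariantFactorsOfModule {m : ℕ} (N : Submodule K[X] (Fin m → K[X]))
    (d : Fin m → K[X]) : Prop :=
  IsNormalizedChain d ∧ ∃ b : Module.Basis (Fin m) K[X] (Fin m → K[X]),
    N = Submodule.span K[X] (Set.range fun i => d i • b i)

/-- `d` lists the invariant factors of the square matrix `A`: the diagonal matrix of `d` is a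
Smith normal form of `A`. -/
def IsInvariantFactorsOfMatrix {n : ℕ} (A : Matrix (Fin n) (Fin n) K[X])
    (d : Fin n → K[X]) : Prop :=
  IsNormalizedChain d ∧ ∃ U V : (Matrix (Fin n) (Fin n) K[X])ˣ,
    U.val * A * V.val = Matrix.diagonal d

/-- The matrix of multiplication by `a` in `K[x]/(f)`, in the basis `1, x, …, x^(n-1)` where
`n = deg f`. -/
noncomputable def mulMatrix (a f : K[X]) (hf : f ≠ 0) :
    Matrix (Fin f.natDegree) (Fin f.natDegree) K :=
  Algebra.leftMulMatrix (AdjoinRoot.powerBasisAux hf) (AdjoinRoot.mk f a)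

end Relations

/-!
The relations of arbitrary `x`-degree form an ideal of `K[y][x]`. For each `j`, the coefficients of
`x ^ j` in its elements of degree at most `j` form an ideal of `K[y]`, with monic generator `h j`,
and `h (j + 1) ∣ h j`. As Lazard observed, `h j` is attained by an element `h j * g j` with `g j`
monic of degree `j`. The `g j` with `j < m` form a unitriangular basis of `K[y]^m` and the
`h j * g j` generate the relations of degree less than `m`, so `h 0, …, h (m - 1)` are at the same
time the diagonal of a triangular basis of relations and the invariant factors. They do not depend
on `m`, which reduces the comparison with `y I - M_a` to the case `m = n`: there the columns of
`y I - M_a` are relations, every vector is congruent to a constant one modulo these columns, and a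
constant relation vanishes.
-/

section LeadingCoefficients

variable {R : Type*} [CommRing R] {I : Ideal R[X]}

variable (R) in
/-- The vector of the coefficients of `1, X, …, X ^ (m - 1)` in a polynomial, which identifies the
polynomials of degree less than `m` with `R ^ m`. -/
noncomputable def coeffVec (m : ℕ) : R[X] →ₗ[R] Fin m → R :=
  LinearMap.pi fun i => lcoeff R i

theorem mem_map_coeffVec_iff {m : ℕ} {r : Fin m → R} :
    r ∈ (degreeLT R m ⊓ I.ofPolynomial).map (coeffVec R m) ↔
      ∑ i, C (r i) * X ^ (i : ℕ) ∈ I := by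
  constructor
  · rintro ⟨p, ⟨hp, hpI⟩, rfl⟩
    change ∑ i : Fin m, C (p.coeff i) * X ^ (i : ℕ) ∈ I
    rwa [sum_fin (fun i c => C c * X ^ i) (by simp) (mem_degreeLT.1 hp), sum_C_mul_X_pow_eq]
  · refine fun h => ⟨_, ⟨mem_degreeLT.2 (degree_sum_fin_lt r), h⟩, funext fun i => ?_⟩
    simp [coeffVec, coeff_X_pow, Fin.val_inj]

theorem mem_leadingCoeffNth_iff {j : ℕ} {x : R} :
    x ∈ I.leadingCoeffNth j ↔ ∃ p ∈ I, p ∈ degreeLT R (j + 1) ∧ p.coeff j = x := by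
  simp only [Ideal.leadingCoeffNth, Ideal.degreeLE, ← degreeLT_succ_eq_degreeLE,
    Submodule.mem_map, Submodule.mem_inf, Ideal.mem_ofPolynomial, lcoeff_apply]
  exact exists_congr fun p => by tauto

theorem sub_mem_degreeLT_of_coeff_eq {p q : R[X]} {j : ℕ} (hp : p ∈ degreeLT R (j + 1))
    (hq : q ∈ degreeLT R (j + 1)) (h : p.coeff j = q.coeff j) : p - q ∈ degreeLT R j := by
  simp only [mem_degreeLT, degree_lt_iff_coeff_zero] at hp hq ⊢
  intro k hk
  rw [coeff_sub]
  rcases hk.eq_or_lt with rfl | hjk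
  · rw [h, sub_self]
  · rw [hp k hjk, hq k hjk, sub_self]

theorem X_mul_mem_degreeLT {p : R[X]} {j : ℕ} (hp : p ∈ degreeLT R j) :
    X * p ∈ degreeLT R (j + 1) := by
  simp only [mem_degreeLT, degree_lt_iff_coeff_zero] at hp ⊢
  intro k hk
  obtain ⟨k, rfl⟩ := Nat.exists_eq_add_of_lt hk
  rw [coeff_X_mul]
  exact hp _ (Nat.le_add_right j k)

theorem mem_degreeLT_succ_iff {p : R[X]} {j : ℕ} :
    p ∈ degreeLT R (j + 1) ↔ p.natDegree ≤ j := by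
  rw [degreeLT_succ_eq_degreeLE, mem_degreeLE, natDegree_le_iff_degree_le]

theorem exists_sub_C_mul_mem_degreeLT {j : ℕ} {x : R} (hx : I.leadingCoeffNth j = Ideal.span {x})
    {g p : R[X]} (hg : g ∈ degreeLT R (j + 1)) (hgj : g.coeff j = x) (hpI : p ∈ I)
    (hp : p ∈ degreeLT R (j + 1)) :
    ∃ c, p.coeff j = c * x ∧ p - C c * g ∈ degreeLT R j := by
  obtain ⟨c, hc⟩ : x ∣ p.coeff j := by
    rw [← Ideal.mem_span_singleton, ← hx]
    exact mem_leadingCoeffNth_iff.2 ⟨p, hpI, hp, rfl⟩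
  rw [mul_comm] at hc
  refine ⟨c, hc, sub_mem_degreeLT_of_coeff_eq hp ?_ (by rw [coeff_C_mul, hgj, hc])⟩
  rw [C_mul']
  exact Submodule.smul_mem _ c hg

theorem exists_basis_eq_coeffVec {m : ℕ} {g : Fin m → R[X]} (hg : ∀ j, (g j).Monic)
    (hdeg : ∀ j, (g j).natDegree = j) :
    ∃ b : Module.Basis (Fin m) R (Fin m → R), ∀ j, b j = coeffVec R m (g j) := by
  let e := Pi.basisFun R (Fin m)
  let v : Fin m → Fin m → R := fun j => coeffVec R m (g j)
  have hdet : IsUnit (e.det v) := by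
    have h1 : e.det v = 1 := Matrix.det_matrixOfPolynomials g hdeg hg
    exact h1 ▸ isUnit_one
  obtain ⟨hli, hspan⟩ := (Module.Basis.is_basis_iff_det e).2 hdet
  exact ⟨.mk hli hspan.ge, fun j => Module.Basis.mk_apply hli hspan.ge j⟩

variable {h : ℕ → R} (hI : ∀ j, I.leadingCoeffNth j = Ideal.span {h j})

include hI

theorem exists_mem_coeff_eq (j : ℕ) : ∃ g ∈ I, g ∈ degreeLT R (j + 1) ∧ g.coeff j = h j :=
  mem_leadingCoeffNth_iff.1 (hI j ▸ Ideal.mem_span_singleton_self _)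

/-- In the inductive step, `h j = e * h (j + 1)`, where `e` is the factor by which one subtracts the
element `g` attaining `h (j + 1)` from `X` times an element attaining `h j`. By induction `h j`
divides `e * g`, and cancelling `e` leaves `h (j + 1) ∣ g`. -/
theorem C_dvd_of_mem_degreeLT [IsDomain R] (h0 : ∀ j, h j ≠ 0) (j : ℕ) :
    ∀ p ∈ I, p ∈ degreeLT R (j + 1) → C (h j) ∣ p := by
  induction j with
  | zero =>
    intro p hpI hp
    obtain ⟨g, -, hg, hg0⟩ := exists_mem_coeff_eq hI 0
    obtain ⟨c, hc, -⟩ := exists_sub_C_mul_mem_degreeLT (hI _) hg hg0 hpI hp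
    rw [eq_C_of_natDegree_le_zero (mem_degreeLT_succ_iff.1 hp), hc, C_mul]
    exact dvd_mul_left _ _
  | succ j ih =>
    obtain ⟨q, hqI, hq, hqj⟩ := exists_mem_coeff_eq hI j
    obtain ⟨g, hgI, hg, hgj⟩ := exists_mem_coeff_eq hI (j + 1)
    obtain ⟨e, he, hXq⟩ := exists_sub_C_mul_mem_degreeLT (hI _) hg hgj (I.mul_mem_left X hqI)
      (X_mul_mem_degreeLT hq)
    rw [coeff_X_mul, hqj] at he
    have hCg : C (h (j + 1)) ∣ g := by
      have hdvd : C (h j) ∣ C e * g :=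
        (dvd_sub_right ((ih q hqI hq).mul_left X)).1
          (ih _ (I.sub_mem (I.mul_mem_left X hqI) (I.mul_mem_left _ hgI)) hXq)
      have he0 : e ≠ 0 := left_ne_zero_of_mul (he ▸ h0 j)
      rw [he, C_mul] at hdvd
      exact (mul_dvd_mul_iff_left (C_ne_zero.2 he0)).1 hdvd
    intro p hpI hp
    obtain ⟨c, -, hlow⟩ := exists_sub_C_mul_mem_degreeLT (hI _) hg hgj hpI hp
    have hCC : C (h (j + 1)) ∣ C (h j) := map_dvd C (Dvd.intro_left e he.symm)
    exact (dvd_sub_left (hCg.mul_left (C c))).1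
      (hCC.trans (ih _ (I.sub_mem hpI (I.mul_mem_left _ hgI)) hlow))

theorem exists_monic_smul_mem [IsDomain R] (h0 : ∀ j, h j ≠ 0) (j : ℕ) :
    ∃ g : R[X], g.Monic ∧ g.natDegree = j ∧ h j • g ∈ I := by
  obtain ⟨p, hpI, hp, hpj⟩ := exists_mem_coeff_eq hI j
  obtain ⟨g, rfl⟩ := C_dvd_of_mem_degreeLT hI h0 j p hpI hp
  have hgj : g.coeff j = 1 := by
    rw [coeff_C_mul] at hpj
    exact (mul_eq_left₀ (h0 j)).1 hpj
  have hdeg : g.natDegree ≤ j := by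
    rwa [mem_degreeLT_succ_iff, natDegree_C_mul (h0 j)] at hp
  exact ⟨g, monic_of_natDegree_le_of_coeff_eq_one j hdeg hgj,
    natDegree_eq_of_le_of_coeff_ne_zero hdeg (hgj ▸ one_ne_zero), C_mul' (h j) g ▸ hpI⟩

theorem degreeLT_inf_ofPolynomial_eq_span {g : ℕ → R[X]} (hg : ∀ j, (g j).Monic)
    (hdeg : ∀ j, (g j).natDegree = j) (hgI : ∀ j, h j • g j ∈ I) (m : ℕ) :
    degreeLT R m ⊓ I.ofPolynomial =
      Submodule.span R (Set.range fun j : Fin m => h j • g j) := by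
  have hmem (j : ℕ) : h j • g j ∈ degreeLT R (j + 1) :=
    Submodule.smul_mem _ _ (mem_degreeLT_succ_iff.2 (hdeg j).le)
  have hcoeff (j : ℕ) : (h j • g j).coeff j = h j := by
    have hone : (g j).coeff j = 1 := by simpa only [hdeg j] using (hg j).coeff_natDegree
    rw [coeff_smul, hone, smul_eq_mul, mul_one]
  refine le_antisymm ?_ (Submodule.span_le.2 ?_)
  · induction m with
    | zero =>
      rintro p ⟨hp, -⟩
      rw [SetLike.mem_coe, mem_degreeLT, Nat.cast_zero, Nat.WithBot.lt_zero_iff,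
        degree_eq_bot] at hp
      exact hp ▸ zero_mem _
    | succ m ih =>
      rintro p ⟨hp, hpI⟩
      obtain ⟨c, -, hlow⟩ := exists_sub_C_mul_mem_degreeLT (hI m) (hmem m) (hcoeff m) hpI hp
      rw [C_mul'] at hlow
      rw [← sub_add_cancel p (c • h m • g m)]
      have hpI' : p - c • h m • g m ∈ I.ofPolynomial :=
        sub_mem hpI (Submodule.smul_mem _ c (hgI m))
      refine add_mem (Submodule.span_mono ?_ (ih ⟨hlow, hpI'⟩))
        (Submodule.smul_mem _ c (Submodule.subset_span ⟨Fin.last m, rfl⟩))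
      rintro _ ⟨j, rfl⟩
      exact ⟨j.castSucc, rfl⟩
  · rintro _ ⟨j, rfl⟩
    exact ⟨degreeLT_mono j.isLt (hmem j), hgI j⟩

theorem exists_basis_map_coeffVec_eq_span [IsDomain R] (h0 : ∀ j, h j ≠ 0) (m : ℕ) :
    ∃ b : Module.Basis (Fin m) R (Fin m → R), (degreeLT R m ⊓ I.ofPolynomial).map (coeffVec R m) =
      Submodule.span R (Set.range fun i : Fin m => h i • b i) := by
  choose g hg hdeg hgI using exists_monic_smul_mem hI h0
  obtain ⟨b, hb⟩ := exists_basis_eq_coeffVec (m := m) (g := fun j => g j) (fun j => hg j)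
    fun j => hdeg j
  refine ⟨b, ?_⟩
  rw [degreeLT_inf_ofPolynomial_eq_span hI hg hdeg hgI, Submodule.map_span, ← Set.range_comp]
  simp only [hb, Function.comp_def, map_smul]

end LeadingCoefficients

section SmithDivisibility

variable {R M ι : Type*} [CommRing R] [AddCommGroup M] [Module R M]

theorem dvd_repr_of_mem_span_smul (b : Module.Basis ι R M) {d : ι → R} {x : M}
    (hx : x ∈ Submodule.span R (Set.range fun i => d i • b i)) (i : ι) : d i ∣ b.repr x i := by
  classical
  induction hx using Submodule.span_induction with
  | mem x hx =>
    obtain ⟨j, rfl⟩ := hx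
    rcases eq_or_ne j i with rfl | hji
    · simp
    · simp [Finsupp.single_eq_of_ne hji.symm]
  | zero => simp
  | add x y _ _ hx hy => simpa using dvd_add hx hy
  | smul c x _ hx => simpa using hx.mul_left c

variable [LinearOrder ι]

theorem exists_le_perm_le [Finite ι] (i : ι) (s : Equiv.Perm ι) : ∃ k, i ≤ k ∧ s k ≤ i := by
  by_contra! hlt
  have hmaps : Set.MapsTo s (Set.Ici i) (Set.Ici i) := fun k hk => (hlt k hk).le
  obtain ⟨k, hk, hki⟩ := ((Set.toFinite _).injOn_iff_bijOn_of_mapsTo hmaps).1 s.injective.injOn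
    |>.surjOn Set.self_mem_Ici
  exact (hlt k hk).ne' hki

/-- Every term of the Leibniz expansion contains an entry of the block `j ≤ i ≤ k`. -/
theorem dvd_mul_det_of_forall_dvd_mul [Fintype ι] {c x : R} {P : Matrix ι ι R} (i : ι)
    (h : ∀ j k, j ≤ i → i ≤ k → c ∣ x * P j k) : c ∣ x * P.det := by
  rw [Matrix.det_apply', Finset.mul_sum]
  refine Finset.dvd_sum fun s _ => ?_
  obtain ⟨k, hik, hki⟩ := exists_le_perm_le i s
  rw [mul_left_comm]
  have hentry : P (s k) k ∣ ∏ l, P (s l) l :=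
    Finset.dvd_prod_of_mem (fun l => P (s l) l) (Finset.mem_univ k)
  exact ((h _ k hki hik).trans (mul_dvd_mul_left x hentry)).mul_left _

theorem dvd_of_span_smul_le [Finite ι] {b b' : Module.Basis ι R M} {d d' : ι → R}
    (hd : ∀ i j, i ≤ j → d j ∣ d i) (hd' : ∀ i j, i ≤ j → d' j ∣ d' i)
    (h : Submodule.span R (Set.range fun i => d i • b i) ≤
      Submodule.span R (Set.range fun i => d' i • b' i)) (i : ι) : d' i ∣ d i := by
  cases nonempty_fintype ι
  have hentry (j k : ι) : d' j ∣ d k * b'.toMatrix b j k := by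
    simpa [Module.Basis.toMatrix_apply] using
      dvd_repr_of_mem_span_smul b' (h (Submodule.subset_span ⟨k, rfl⟩)) j
  have hdet : d' i ∣ d i * (b'.toMatrix b).det :=
    dvd_mul_det_of_forall_dvd_mul i fun j k hj hk =>
      (hd' j i hj).trans ((hentry j k).trans (mul_dvd_mul_right (hd i k hk) _))
  have hunit : IsUnit (b'.toMatrix b).det := b'.det_apply b ▸ b'.isUnit_det b
  exact hunit.dvd_mul_right.1 hdet

end SmithDivisibility

section ColumnModule

variable {R n p : Type*} [CommRing R] [Fintype n]

theorem exists_eq_mul_iff_col_mem_span {l : Type*} {A : Matrix l p R} {B : Matrix l n R} :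
    (∃ W : Matrix n p R, A = B * W) ↔ ∀ j, A.col j ∈ Submodule.span R (Set.range B.col) := by
  rw [← Matrix.range_mulVecLin]
  constructor
  · rintro ⟨W, rfl⟩ j
    exact ⟨W.col j, rfl⟩
  · intro h
    choose w hw using h
    exact ⟨Matrix.of fun i j => w j i, Matrix.ext fun i j => (congrFun (hw j) i).symm⟩

theorem span_range_col_le_iff_exists_eq_mul {l : Type*} {A : Matrix l p R} {B : Matrix l n R} :
    Submodule.span R (Set.range A.col) ≤ Submodule.span R (Set.range B.col) ↔
      ∃ W : Matrix n p R, A = B * W := by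
  rw [exists_eq_mul_iff_col_mem_span, Submodule.span_le, Set.range_subset_iff]
  rfl

variable [DecidableEq n]

theorem span_range_col_eq_iff_exists_unit [IsDomain R] {A B : Matrix n n R} (hA : A.det ≠ 0) :
    Submodule.span R (Set.range A.col) = Submodule.span R (Set.range B.col) ↔
      ∃ V : (Matrix n n R)ˣ, A * V.val = B := by
  constructor
  · intro h
    obtain ⟨W, hW⟩ := span_range_col_le_iff_exists_eq_mul.1 h.le
    obtain ⟨V, hV⟩ := span_range_col_le_iff_exists_eq_mul.1 h.ge
    have hdet : A.det * (V.det * W.det) = A.det * 1 := by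
      rw [← mul_assoc, ← Matrix.det_mul, ← hV, ← Matrix.det_mul, ← hW, mul_one]
    obtain ⟨U, rfl⟩ := (Matrix.isUnit_iff_isUnit_det V).2
      (IsUnit.of_mul_eq_one _ (mul_left_cancel₀ hA hdet))
    exact ⟨U, hV.symm⟩
  · rintro ⟨V, rfl⟩
    refine le_antisymm ?_ ?_ <;> rw [span_range_col_le_iff_exists_eq_mul]
    · exact ⟨V⁻¹.val, by rw [Matrix.mul_assoc, V.mul_inv, mul_one]⟩
    · exact ⟨V.val, rfl⟩

theorem col_mul_diagonal {l : Type*} (P : Matrix l n R) (d : n → R) :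
    (P * Matrix.diagonal d).col = fun j => d j • P.col j := by
  ext j i
  simp [mul_comm]

theorem exists_basis_eq_col_iff {P : Matrix n n R} :
    (∃ b : Module.Basis n R (n → R), ⇑b = P.col) ↔ IsUnit P := by
  have hdet : (Pi.basisFun R n).det P.col = P.det := rfl
  rw [Matrix.isUnit_iff_isUnit_det, ← hdet, ← Module.Basis.is_basis_iff_det]
  constructor
  · rintro ⟨b, hb⟩
    exact hb ▸ ⟨b.linearIndependent, b.span_eq⟩
  · rintro ⟨hli, hspan⟩
    exact ⟨.mk hli hspan.ge, Module.Basis.coe_mk hli hspan.ge⟩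

end ColumnModule

section SumsAndProducts

theorem associated_of_dvd_of_associated_prod {ι M : Type*} [Fintype ι] [CommMonoidWithZero M]
    [IsCancelMulZero M] {x y : ι → M} (hdvd : ∀ i, x i ∣ y i) (hx : ∀ i, x i ≠ 0)
    (hprod : Associated (∏ i, x i) (∏ i, y i)) (i : ι) : Associated (x i) (y i) := by
  have : Nontrivial M := nontrivial_of_ne _ _ (hx i)
  choose c hc using hdvd
  have hunit : IsUnit (∏ j, c j) := by
    obtain ⟨u, hu⟩ := hprod
    simp only [hc, Finset.prod_mul_distrib] at hu
    exact mul_left_cancel₀ (Finset.prod_ne_zero_iff.2 fun j _ => hx j) hu ▸ u.isUnit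
  rw [hc i]
  exact associated_mul_unit_right _ _
    (isUnit_of_dvd_unit (Finset.dvd_prod_of_mem c (Finset.mem_univ i)) hunit)

theorem sum_fin_eq_sum_filter_lt {M : Type*} [AddCommMonoid M] {e : ℕ → M} {n : ℕ}
    (he : ∀ j, n ≤ j → e j = 0) (m : ℕ) :
    ∑ i : Fin m, e i = ∑ i ∈ Finset.univ.filter (fun i : Fin n => (i : ℕ) < m), e i := by
  rw [Finset.sum_filter, Fin.sum_univ_eq_sum_range e,
    Fin.sum_univ_eq_sum_range fun i => if i < m then e i else 0, ← Finset.sum_filter]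
  refine (Finset.sum_subset (fun i hi => ?_) fun i him hi => he i ?_).symm
  · exact Finset.mem_range.2 (Finset.mem_filter.1 hi).2
  · simp_all

theorem min_sum_fin_le_sum_fin {e : ℕ → ℕ} (he : Antitone e) (m n : ℕ) :
    min m (∑ i : Fin n, e i) ≤ ∑ i : Fin m, e i := by
  by_cases hpos : ∀ i : Fin m, 0 < e i
  · calc min m (∑ i : Fin n, e i) ≤ ∑ _i : Fin m, 1 := by simp
      _ ≤ ∑ i : Fin m, e i := Finset.sum_le_sum fun i _ => hpos i
  · obtain ⟨i, hi⟩ := not_forall.1 hpos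
    have hzero (j : ℕ) (hj : m ≤ j) : e j = 0 :=
      Nat.le_zero.1 ((he (i.isLt.le.trans hj)).trans (not_lt.1 hi))
    rw [sum_fin_eq_sum_filter_lt hzero n]
    exact (min_le_right _ _).trans (Finset.sum_le_sum_of_subset (Finset.filter_subset _ _))

end SumsAndProducts

section RelationMatrices

variable {K : Type*} [Field K] {m : ℕ} {N : Submodule K[X] (Fin m → K[X])}
  {A B : Matrix (Fin m) (Fin m) K[X]} {d : Fin m → K[X]}

theorem IsBasisOfRelations.det_dvd_det (hB : IsBasisOfRelations N B)
    (hA : IsMatrixOfRelations N A) : B.det ∣ A.det := by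
  obtain ⟨W, rfl⟩ := exists_eq_mul_iff_col_mem_span.2 fun j => hB.2.ge (hA.2 j)
  rw [Matrix.det_mul]
  exact dvd_mul_right _ _

theorem IsBasisOfRelations.associated_det (hA : IsBasisOfRelations N A)
    (hB : IsBasisOfRelations N B) : Associated A.det B.det :=
  associated_of_dvd_dvd (hA.det_dvd_det hB.1) (hB.det_dvd_det hA.1)

theorem IsBasisOfRelations.determinantalDegree_eq (hB : IsBasisOfRelations N B) :
    determinantalDegree N = B.det.natDegree := by
  refine le_antisymm (Nat.sInf_le ⟨B, hB.1, rfl⟩) (le_csInf ⟨_, B, hB.1, rfl⟩ ?_)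
  rintro _ ⟨A, hA, rfl⟩
  exact natDegree_le_of_dvd (hB.det_dvd_det hA) hA.1

theorem isInvariantFactorsOfModule_iff_exists_unit :
    IsInvariantFactorsOfModule N d ↔ IsNormalizedChain d ∧ ∃ P : (Matrix (Fin m) (Fin m) K[X])ˣ,
      N = Submodule.span K[X] (Set.range (P.val * Matrix.diagonal d).col) := by
  simp only [IsInvariantFactorsOfModule, col_mul_diagonal]
  refine and_congr_right fun _ => ⟨?_, ?_⟩
  · rintro ⟨b, rfl⟩
    exact ⟨(exists_basis_eq_col_iff (P := .of fun i j => b j i).1 ⟨b, rfl⟩).unit, rfl⟩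
  · rintro ⟨P, rfl⟩
    obtain ⟨b, hb⟩ := exists_basis_eq_col_iff.2 P.isUnit
    exact ⟨b, by rw [hb]⟩

theorem IsInvariantFactorsOfModule.exists_isBasisOfRelations (h : IsInvariantFactorsOfModule N d)
    (h0 : ∀ i, d i ≠ 0) : ∃ B, IsBasisOfRelations N B ∧ Associated (∏ i, d i) B.det := by
  obtain ⟨-, P, hP⟩ := isInvariantFactorsOfModule_iff_exists_unit.1 h
  have hdet : Associated (∏ i, d i) (P.val * Matrix.diagonal d).det := by
    rw [Matrix.det_mul, Matrix.det_diagonal]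
    exact associated_unit_mul_right _ _ ((Matrix.isUnit_iff_isUnit_det _).1 P.isUnit)
  refine ⟨_, ⟨⟨hdet.ne_zero_iff.1 (Finset.prod_ne_zero_iff.2 fun i _ => h0 i), fun j => ?_⟩,
    hP.symm⟩, hdet⟩
  exact hP.ge (Submodule.subset_span ⟨j, rfl⟩)

theorem IsInvariantFactorsOfModule.associated_prod_det (h : IsInvariantFactorsOfModule N d)
    (h0 : ∀ i, d i ≠ 0) (hB : IsBasisOfRelations N B) : Associated (∏ i, d i) B.det := by
  obtain ⟨A, hA, hdA⟩ := h.exists_isBasisOfRelations h0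
  exact hdA.trans (hA.associated_det hB)

theorem IsInvariantFactorsOfModule.determinantalDegree_eq (h : IsInvariantFactorsOfModule N d)
    (h0 : ∀ i, d i ≠ 0) : determinantalDegree N = ∑ i, (d i).natDegree := by
  obtain ⟨B, hB, hdB⟩ := h.exists_isBasisOfRelations h0
  rw [hB.determinantalDegree_eq, ← natDegree_prod _ _ fun i _ => h0 i]
  exact natDegree_eq_of_degree_eq (degree_eq_degree_of_associated hdB.symm)

theorem IsNormalizedChain.eq_of_dvd {d' : Fin m → K[X]} (hd : IsNormalizedChain d)
    (hd' : IsNormalizedChain d') (h : ∀ i, d i ∣ d' i) (h' : ∀ i, d' i ∣ d i) : d = d' := by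
  ext1 i
  rcases hd.1 i with h0 | hmonic
  · rw [h0, zero_dvd_iff.1 (h0 ▸ h i : 0 ∣ d' i)]
  rcases hd'.1 i with h0 | hmonic'
  · rw [h0, zero_dvd_iff.1 (h0 ▸ h' i : 0 ∣ d i)]
  exact eq_of_monic_of_associated hmonic hmonic' (associated_of_dvd_dvd (h i) (h' i))

theorem IsInvariantFactorsOfModule.unique {d' : Fin m → K[X]} (h : IsInvariantFactorsOfModule N d)
    (h' : IsInvariantFactorsOfModule N d') : d = d' := by
  obtain ⟨hd, b, hb⟩ := h
  obtain ⟨hd', b', hb'⟩ := h'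
  exact hd.eq_of_dvd hd' (dvd_of_span_smul_le hd'.2 hd.2 (hb' ▸ hb.le))
    (dvd_of_span_smul_le hd.2 hd'.2 (hb ▸ hb'.le))

theorem IsInvariantFactorsOfModule.iff_eq {d' : Fin m → K[X]} (h : IsInvariantFactorsOfModule N d) :
    IsInvariantFactorsOfModule N d' ↔ d' = d :=
  ⟨fun h' => h'.unique h, fun hdd' => hdd' ▸ h⟩

theorem IsBasisOfRelations.isInvariantFactorsOfMatrix_iff (hA : IsBasisOfRelations N A) :
    IsInvariantFactorsOfMatrix A d ↔ IsInvariantFactorsOfModule N d := by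
  rw [isInvariantFactorsOfModule_iff_exists_unit]
  refine and_congr_right fun _ => ?_
  have hspan : Submodule.span K[X] (Set.range A.col) = N := hA.2
  simp_rw [← hspan, span_range_col_eq_iff_exists_unit hA.1.1]
  constructor
  · rintro ⟨U, V, hUV⟩
    exact ⟨U⁻¹, V, by rw [← hUV, mul_assoc, Units.inv_mul_cancel_left]⟩
  · rintro ⟨P, V, hPV⟩
    exact ⟨P⁻¹, V, by rw [mul_assoc, hPV, Units.inv_mul_cancel_left]⟩

end RelationMatrices

section CharacteristicMatrix

theorem exists_eq_C_add_X_sub_C_mul {A : Type*} [Ring A] (x : A) (p : A[X]) :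
    ∃ (w : A) (q : A[X]), p = C w + (X - C x) * q := by
  nontriviality A
  refine ⟨(p %ₘ (X - C x)).coeff 0, p /ₘ (X - C x), ?_⟩
  have hrem : (p %ₘ (X - C x)).degree < 1 := by
    simpa only [degree_X_sub_C] using degree_modByMonic_lt p (monic_X_sub_C x)
  rw [← eq_C_of_degree_le_zero (Nat.WithBot.lt_one_iff_le_zero.1 hrem), modByMonic_add_div]

variable {R n : Type*} [CommRing R] [Fintype n] [DecidableEq n]

theorem exists_eq_map_C_add_charmatrix_mul (M : Matrix n n R) (P : Matrix n n R[X]) :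
    ∃ (W : Matrix n n R) (Q : Matrix n n R[X]), P = W.map C + M.charmatrix * Q := by
  obtain ⟨W, q, hP⟩ := exists_eq_C_add_X_sub_C_mul M (matPolyEquiv P)
  refine ⟨W, matPolyEquiv.symm q, matPolyEquiv.injective ?_⟩
  rw [← matPolyEquiv_symm_C, map_add, map_mul, Matrix.matPolyEquiv_charmatrix,
    AlgEquiv.apply_symm_apply, AlgEquiv.apply_symm_apply, hP]

theorem exists_eq_C_add_charmatrix_mulVec (M : Matrix n n R) (v : n → R[X]) :
    ∃ (w : n → R) (q : n → R[X]), v = (fun i => C (w i)) + M.charmatrix.mulVec q := by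
  rcases isEmpty_or_nonempty n with _ | ⟨⟨j⟩⟩
  · exact ⟨0, 0, Subsingleton.elim _ _⟩
  · obtain ⟨W, Q, hP⟩ := exists_eq_map_C_add_charmatrix_mul M (.of fun i _ => v i)
    exact ⟨W.col j, Q.col j, funext fun i => congrFun (congrFun hP i) j⟩

theorem sum_aeval_charmatrix_leftMulMatrix_mul {A : Type*} [CommRing A] [Algebra R A]
    (b : Module.Basis n R A) (x : A) (j : n) :
    ∑ i, aeval x ((Algebra.leftMulMatrix b x).charmatrix i j) * b i = 0 := by
  have hmul : ∑ i, Algebra.leftMulMatrix b x i j • b i = x * b j := by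
    simpa only [Algebra.leftMulMatrix_eq_repr_mul] using b.sum_repr (x * b j)
  have hentry (i : n) : aeval x ((Algebra.leftMulMatrix b x).charmatrix i j) =
      Matrix.diagonal (fun _ => x) i j - algebraMap R A (Algebra.leftMulMatrix b x i j) := by
    rw [Matrix.charmatrix_apply, map_sub, aeval_C]
    rcases eq_or_ne i j with rfl | hij
    · simp
    · simp [hij]
  simp only [hentry, sub_mul, Finset.sum_sub_distrib, ← Algebra.smul_def, hmul]
  simp [Matrix.diagonal_apply, ite_mul]

end CharacteristicMatrix

section RelationIdeal

variable {K : Type*} [Field K] {a f : K[X]}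

/-- The ideal of all bivariate relations, of any `x`-degree, as the kernel of the evaluation at the
classes of `a` and `x` in `K[x]/(f)`. In `K[X][X]`, the outer variable stands for `x` and the inner
one for `y`. -/
noncomputable def relationIdeal (a f : K[X]) : Ideal K[X][X] :=
  RingHom.ker (eval₂RingHom (aeval (AdjoinRoot.mk f a) : K[X] →ₐ[K] AdjoinRoot f).toRingHom
    (AdjoinRoot.root f))

theorem mem_relationIdeal_iff {p : K[X][X]} : p ∈ relationIdeal a f ↔
    eval₂ (aeval (AdjoinRoot.mk f a) : K[X] →ₐ[K] AdjoinRoot f).toRingHom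
      (AdjoinRoot.root f) p = 0 :=
  Iff.rfl

theorem mem_relationModule_iff {m : ℕ} {r : Fin m → K[X]} : r ∈ relationModule a f m ↔
    ∑ i : Fin m, aeval (AdjoinRoot.mk f a) (r i) * AdjoinRoot.root f ^ (i : ℕ) = 0 := by
  have hcomp (p : K[X]) : AdjoinRoot.mk f (p.comp a) = aeval (AdjoinRoot.mk f a) p := by
    rw [comp_eq_aeval]
    exact (aeval_algHom_apply (AdjoinRoot.mkₐ f) a p).symm
  change f ∣ ∑ i : Fin m, (r i).comp a * X ^ (i : ℕ) ↔ _
  simp only [← AdjoinRoot.mk_eq_zero, map_sum, map_mul, map_pow, AdjoinRoot.mk_X, hcomp]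

theorem mem_relationModule_iff_sum_mem {m : ℕ} {r : Fin m → K[X]} : r ∈ relationModule a f m ↔
    ∑ i : Fin m, C (r i) * X ^ (i : ℕ) ∈ relationIdeal a f := by
  rw [mem_relationModule_iff, mem_relationIdeal_iff, eval₂_finsetSum]
  simp only [eval₂_mul, eval₂_C, eval₂_X_pow, AlgHom.toRingHom_eq_coe, RingHom.coe_coe]

theorem relationModule_eq_map_coeffVec (a f : K[X]) (m : ℕ) : relationModule a f m =
    (degreeLT K[X] m ⊓ (relationIdeal a f).ofPolynomial).map (coeffVec K[X] m) :=
  SetLike.ext fun _ => mem_relationModule_iff_sum_mem.trans mem_map_coeffVec_iff.symm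

theorem C_minpoly_mem_relationIdeal (a f : K[X]) :
    C (minpoly K (AdjoinRoot.mk f a)) ∈ relationIdeal a f := by
  rw [mem_relationIdeal_iff, eval₂_C]
  exact minpoly.aeval K _

theorem leadingCoeffNth_relationIdeal_ne_bot (a : K[X]) (hf : f ≠ 0) (j : ℕ) :
    (relationIdeal a f).leadingCoeffNth j ≠ ⊥ := by
  have : Module.Finite K (AdjoinRoot f) := (AdjoinRoot.powerBasis hf).finite
  have hmem : minpoly K (AdjoinRoot.mk f a) ∈ (relationIdeal a f).leadingCoeffNth j :=
    Ideal.leadingCoeffNth_mono _ j.zero_le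
      ((Ideal.mem_leadingCoeffNth_zero _ _).2 (C_minpoly_mem_relationIdeal a f))
  exact (Submodule.ne_bot_iff _).2 ⟨_, hmem, minpoly.ne_zero (Algebra.IsIntegral.isIntegral _)⟩

/-- The monic generator of the ideal of the coefficients of `x ^ j` in the relations of `x`-degree
at most `j`: these are the invariant factors of the modules of relations. -/
noncomputable def relationFactor (a f : K[X]) (j : ℕ) : K[X] :=
  Submodule.IsPrincipal.generator ((relationIdeal a f).leadingCoeffNth j) *
    C (Submodule.IsPrincipal.generator ((relationIdeal a f).leadingCoeffNth j)).leadingCoeff⁻¹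

theorem generator_leadingCoeffNth_relationIdeal_ne_zero (a : K[X]) (hf : f ≠ 0) (j : ℕ) :
    Submodule.IsPrincipal.generator ((relationIdeal a f).leadingCoeffNth j) ≠ 0 :=
  (Submodule.IsPrincipal.eq_bot_iff_generator_eq_zero _).not.1
    (leadingCoeffNth_relationIdeal_ne_bot a hf j)

theorem monic_relationFactor (a : K[X]) (hf : f ≠ 0) (j : ℕ) : (relationFactor a f j).Monic :=
  monic_mul_leadingCoeff_inv (generator_leadingCoeffNth_relationIdeal_ne_zero a hf j)

theorem leadingCoeffNth_relationIdeal (a : K[X]) (hf : f ≠ 0) (j : ℕ) :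
    (relationIdeal a f).leadingCoeffNth j = Ideal.span {relationFactor a f j} := by
  have h0 := leadingCoeff_ne_zero.2 (generator_leadingCoeffNth_relationIdeal_ne_zero a hf j)
  rw [relationFactor, Ideal.span_singleton_mul_right_unit (isUnit_C.2 (inv_ne_zero h0).isUnit),
    Ideal.span_singleton_generator]

theorem relationFactor_dvd_of_le (a : K[X]) (hf : f ≠ 0) {i j : ℕ} (h : i ≤ j) :
    relationFactor a f j ∣ relationFactor a f i := by
  rw [← Ideal.span_singleton_le_span_singleton, ← leadingCoeffNth_relationIdeal a hf,
    ← leadingCoeffNth_relationIdeal a hf]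
  exact Ideal.leadingCoeffNth_mono _ h

theorem relationFactor_eq_one (a : K[X]) (hf : f ≠ 0) {j : ℕ} (hj : f.natDegree ≤ j) :
    relationFactor a f j = 1 := by
  have hmem : f.map C ∈ relationIdeal a f := by
    have hC : (aeval (AdjoinRoot.mk f a) : K[X] →ₐ[K] AdjoinRoot f).toRingHom.comp C =
        AdjoinRoot.of f := RingHom.ext (aeval_C _)
    rw [mem_relationIdeal_iff, eval₂_map, hC, AdjoinRoot.eval₂_root]
  have hcoeff : C f.leadingCoeff ∈ (relationIdeal a f).leadingCoeffNth f.natDegree :=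
    mem_leadingCoeffNth_iff.2 ⟨_, hmem, mem_degreeLT_succ_iff.2 natDegree_map_le, coeff_map C _⟩
  rw [leadingCoeffNth_relationIdeal a hf, Ideal.mem_span_singleton] at hcoeff
  have hunit : IsUnit (C f.leadingCoeff) := isUnit_C.2 (leadingCoeff_ne_zero.2 hf).isUnit
  exact (monic_relationFactor a hf j).eq_one_of_isUnit
    (isUnit_of_dvd_unit ((relationFactor_dvd_of_le a hf hj).trans hcoeff) hunit)

theorem relationFactor_dvd_apply (hf : f ≠ 0) {m : ℕ} {r : Fin m → K[X]}
    (hr : r ∈ relationModule a f m) {i : Fin m} (h : ∀ j, i < j → r j = 0) :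
    relationFactor a f i ∣ r i := by
  rw [← Ideal.mem_span_singleton, ← leadingCoeffNth_relationIdeal a hf]
  refine mem_leadingCoeffNth_iff.2 ⟨_, mem_relationModule_iff_sum_mem.1 hr,
    Submodule.sum_mem _ fun j _ => mem_degreeLT_succ_iff.2 ?_, ?_⟩
  · rcases le_or_gt j i with hj | hj
    · exact (natDegree_C_mul_X_pow_le _ _).trans hj
    · simp [h j hj]
  · simp [coeff_X_pow, Fin.val_inj]

theorem isInvariantFactorsOfModule_relationFactor (a : K[X]) (hf : f ≠ 0) (m : ℕ) :
    IsInvariantFactorsOfModule (relationModule a f m) fun i => relationFactor a f i := by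
  refine ⟨⟨fun i => .inr (monic_relationFactor a hf i), fun _ _ h =>
    relationFactor_dvd_of_le a hf h⟩, ?_⟩
  rw [relationModule_eq_map_coeffVec]
  exact exists_basis_map_coeffVec_eq_span (leadingCoeffNth_relationIdeal a hf)
    (fun j => (monic_relationFactor a hf j).ne_zero) m

theorem antitone_natDegree_relationFactor (a : K[X]) (hf : f ≠ 0) :
    Antitone fun j => (relationFactor a f j).natDegree := fun _ _ h =>
  natDegree_le_of_dvd (relationFactor_dvd_of_le a hf h) (monic_relationFactor a hf _).ne_zero

theorem determinantalDegree_relationModule (a : K[X]) (hf : f ≠ 0) (m : ℕ) :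
    determinantalDegree (relationModule a f m) = ∑ i : Fin m, (relationFactor a f i).natDegree :=
  (isInvariantFactorsOfModule_relationFactor a hf m).determinantalDegree_eq
    fun i => (monic_relationFactor a hf i).ne_zero

theorem exists_forall_not_isUnit_relationFactor_iff (a : K[X]) (hf : f ≠ 0) :
    ∃ k ≤ f.natDegree, ∀ j, ¬ IsUnit (relationFactor a f j) ↔ j < k := by
  classical
  have hn : IsUnit (relationFactor a f f.natDegree) :=
    relationFactor_eq_one a hf le_rfl ▸ isUnit_one
  have hex : ∃ k, IsUnit (relationFactor a f k) := ⟨_, hn⟩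
  refine ⟨Nat.find hex, Nat.find_min' hex hn, fun j => ⟨fun hj => ?_, Nat.find_min hex⟩⟩
  by_contra! hle
  exact hj (isUnit_of_dvd_unit (relationFactor_dvd_of_le a hf hle) (Nat.find_spec hex))

theorem IsBasisOfRelations.exists_diag_eq_C_mul (hf : f ≠ 0) {m : ℕ}
    {B : Matrix (Fin m) (Fin m) K[X]} (hB : IsBasisOfRelations (relationModule a f m) B)
    (hT : B.BlockTriangular id) (i : Fin m) :
    ∃ c : K, c ≠ 0 ∧ B i i = C c * relationFactor a f i := by
  have h0 (j : Fin m) : relationFactor a f j ≠ 0 := (monic_relationFactor a hf j).ne_zero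
  have hdvd (j : Fin m) : relationFactor a f j ∣ B j j :=
    relationFactor_dvd_apply hf (hB.1.2 j) fun _ hj => hT hj
  have hprod := (isInvariantFactorsOfModule_relationFactor a hf m).associated_prod_det h0 hB
  rw [Matrix.det_of_isUpperTriangular hT] at hprod
  obtain ⟨u, hu⟩ := associated_of_dvd_of_associated_prod hdvd h0 hprod i
  obtain ⟨c, hc, hcu⟩ := Polynomial.isUnit_iff.1 u.isUnit
  exact ⟨c, hc.ne_zero, by rw [← hu, ← hcu, mul_comm]⟩

end RelationIdeal

section CharacteristicMatrixRelations

variable {K : Type*} [Field K] {f : K[X]}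

theorem powerBasisAux_apply (hf : f ≠ 0) (i : Fin f.natDegree) :
    AdjoinRoot.powerBasisAux hf i = AdjoinRoot.root f ^ (i : ℕ) :=
  (AdjoinRoot.powerBasis hf).basis_eq_pow i

theorem charmatrix_col_mem_relationModule (a : K[X]) (hf : f ≠ 0) (j : Fin f.natDegree) :
    (mulMatrix a f hf).charmatrix.col j ∈ relationModule a f f.natDegree := by
  rw [mem_relationModule_iff]
  simp only [← powerBasisAux_apply hf]
  exact sum_aeval_charmatrix_leftMulMatrix_mul (AdjoinRoot.powerBasisAux hf) (AdjoinRoot.mk f a) j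

theorem eq_zero_of_C_mem_relationModule {a : K[X]} (hf : f ≠ 0) {w : Fin f.natDegree → K}
    (h : (fun i => C (w i)) ∈ relationModule a f f.natDegree) : w = 0 := by
  rw [mem_relationModule_iff] at h
  simp only [aeval_C, ← powerBasisAux_apply hf, ← Algebra.smul_def] at h
  exact funext (Fintype.linearIndependent_iff.1 (AdjoinRoot.powerBasisAux hf).linearIndependent w h)

theorem isBasisOfRelations_charmatrix (a : K[X]) (hf : f ≠ 0) :
    IsBasisOfRelations (relationModule a f f.natDegree) (mulMatrix a f hf).charmatrix := by
  have hcol := charmatrix_col_mem_relationModule a hf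
  refine ⟨⟨(Matrix.charpoly_monic _).ne_zero, hcol⟩,
    le_antisymm (Submodule.span_le.2 (Set.range_subset_iff.2 hcol)) fun r hr => ?_⟩
  obtain ⟨w, q, rfl⟩ := exists_eq_C_add_charmatrix_mulVec (mulMatrix a f hf) r
  have hq : (mulMatrix a f hf).charmatrix.mulVec q ∈
      Submodule.span K[X] (Set.range (mulMatrix a f hf).charmatrix.col) :=
    Matrix.range_mulVecLin (mulMatrix a f hf).charmatrix ▸ ⟨q, rfl⟩
  have hw : w = 0 := eq_zero_of_C_mem_relationModule hf <| by
    simpa using sub_mem hr (Submodule.span_le.2 (Set.range_subset_iff.2 hcol) hq)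
  have hCw : (fun i => C (w i)) = 0 := funext fun i => by simp [hw]
  rw [hCw, zero_add]
  exact hq

theorem sum_natDegree_relationFactor (a : K[X]) (hf : f ≠ 0) :
    ∑ i : Fin f.natDegree, (relationFactor a f i).natDegree = f.natDegree := by
  rw [← determinantalDegree_relationModule a hf,
    (isBasisOfRelations_charmatrix a hf).determinantalDegree_eq]
  exact (Matrix.charpoly_natDegree_eq_dim _).trans (Fintype.card_fin _)

end CharacteristicMatrixRelations

theorem mainTheorem6 {K : Type*} [Field K] (a f : K[X]) (hf : f ≠ 0) (m : ℕ) (hm : 1 ≤ m) :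
    ∃ (d : Fin m → K[X]) (σ : Fin f.natDegree → K[X]),
      -- `d` is the list of invariant factors of the module of relations
      (∀ d', IsInvariantFactorsOfModule (relationModule a f m) d' ↔ d' = d) ∧
      -- `σ` is the list of invariant factors of the characteristic matrix
      (∀ σ', IsInvariantFactorsOfMatrix (mulMatrix a f hf).charmatrix σ' ↔ σ' = σ) ∧
      -- diagonal entries of an upper triangular basis
      (∀ B : Matrix (Fin m) (Fin m) K[X], IsBasisOfRelations (relationModule a f m) B →
        B.BlockTriangular id → ∀ i, ∃ c : K, c ≠ 0 ∧ B i i = C c * d i) ∧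
      -- the nontrivial invariant factors
      (∃ (k : ℕ) (hk : k ≤ min m f.natDegree),
        (∀ i : Fin m, ¬ IsUnit (d i) ↔ (i : ℕ) < k) ∧
        ∀ i : Fin k, d (i.castLE (hk.trans (min_le_left _ _))) =
          σ (i.castLE (hk.trans (min_le_right _ _)))) ∧
      -- the characteristic matrix is a basis of relations
      IsBasisOfRelations (relationModule a f f.natDegree) (mulMatrix a f hf).charmatrix ∧
      -- the determinantal degree
      determinantalDegree (relationModule a f m) = ∑ i, (d i).natDegree ∧
      determinantalDegree (relationModule a f m) =
        ∑ i ∈ Finset.univ.filter (fun i : Fin f.natDegree => (i : ℕ) < m), (σ i).natDegree ∧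
      min m f.natDegree ≤ determinantalDegree (relationModule a f m) ∧
      determinantalDegree (relationModule a f m) ≤ f.natDegree := by
  have hd (m : ℕ) := isInvariantFactorsOfModule_relationFactor a hf m
  have hA := isBasisOfRelations_charmatrix a hf
  have hν := determinantalDegree_relationModule a hf m
  have hsum := sum_natDegree_relationFactor a hf
  have htrunc := sum_fin_eq_sum_filter_lt (e := fun j => (relationFactor a f j).natDegree)
    (n := f.natDegree) (fun j hj => by simp only [relationFactor_eq_one a hf hj, natDegree_one]) m
  refine ⟨fun i => relationFactor a f i, fun i => relationFactor a f i, fun _ => (hd m).iff_eq,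
    fun _ => hA.isInvariantFactorsOfMatrix_iff.trans (hd f.natDegree).iff_eq,
    fun _ hB hT => hB.exists_diag_eq_C_mul hf hT, ?_, hA, hν, hν.trans htrunc, ?_, ?_⟩
  · obtain ⟨k, hk, hunit⟩ := exists_forall_not_isUnit_relationFactor_iff a hf
    exact ⟨min m k, min_le_min_left m hk, fun i => by simp [hunit], fun _ => rfl⟩
  · have hmin := min_sum_fin_le_sum_fin (antitone_natDegree_relationFactor a hf) m f.natDegree
    rwa [hsum, ← hν] at hmin
  · calc determinantalDegree (relationModule a f m)
        = ∑ i ∈ Finset.univ.filter (fun i : Fin f.natDegree => (i : ℕ) < m),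
            (relationFactor a f i).natDegree := hν.trans htrunc
      _ ≤ ∑ i : Fin f.natDegree, (relationFactor a f i).natDegree :=
          Finset.sum_le_sum_of_subset (Finset.filter_subset _ _)
      _ = f.natDegree := hsum
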